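/- Let $X$ be a Noetherian scheme, $L$ an invertible sheaf on $X$, and $W\in\Gamma(X,L)$ a global section that is a non-zero-divisor, i.e. the induced homomorphism $W:\mathcal O_X\to L$ is injective. Let $i:X_0\hookrightarrow X$ be the zero scheme of $W$, i.e. the closed subscheme whose ideal sheaf is generated by $w$ wherever $W=w\,e$ in a local frame $e$ of $L$. The singular locus of $X_0$ locally relative to $X$, denoted $\operatorname{Sing^{loc}}(X_0/X)$, is the set of points $p\in X_0$ for which there is a finitely generated $\mathcal O_{X_0,p}$-module $M$ that is not perfect over $\mathcal O_{X_0,p}$ but is perfect when regarded as an $\mathcal O_{X,p}$-module via the surjection $\mathcal O_{X,p}\to\mathcal O_{X_0,p}$; here a module over a local ring is called perfect if it is quasi-isomorphic to a bounded complex of free modules of finite rank. For a Noetherian local ring $(R,\mathfrak m)$ put $$\operatorname{codim}(R):=\operatorname{emb.dim}(R)-\dim(R),\qquad \operatorname{emb.dim}(R):=\dim_{R/\mathfrak m}(\mathfrak m/\mathfrak m^2).$$ Assume that $\dim(\mathcal O_{X,p})-\dim(\mathcal O_{X_0,p})=1$ for every $p\in X_0$. Then $$\operatorname{Sing^{loc}}(X_0/X)=\{\,p\in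 X_0\mid \operatorname{codim}(\mathcal O_{X_0,p})>\operatorname{codim}(\mathcal O_{X,p})\,\}.$$ -/

import Mathlib

open CategoryTheory Opposite AlgebraicGeometry TopologicalSpace

universe u

noncomputable section

namespace RelSing

/-! ### Invertible sheaves, their sections and zero schemes -/

section ZeroScheme

variable {X : Scheme.{u}} (L : X.Modules)

/-- The restriction of a section of a sheaf of modules to a smaller open set. -/
def res {U V : X.Opens} (h : V ≤ U) (s : Γ(L, U)) : Γ(L, V) :=
  (L.presheaf.map (homOfLE h).op).hom s

/-- The restriction of a regular function to a smaller open set. -/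
def resO {U V : X.Opens} (h : V ≤ U) (r : Γ(X, U)) : Γ(X, V) :=
  (X.presheaf.map (homOfLE h).op).hom r

/-- A section `e` of `L` over `U` is a frame if multiplication by `e` is an isomorphism of sheaves
`𝒪_U ≅ L|_U`. -/
def IsFrame {U : X.Opens} (e : Γ(L, U)) : Prop :=
  ∀ (V : X.Opens) (h : V ≤ U), Function.Bijective (fun r : Γ(X, V) => r • res L h e)

/-- `L` is an invertible sheaf (a line bundle): it is locally isomorphic to the structure sheaf. -/
def IsInvertibleSheaf : Prop :=
  ∀ x : X, ∃ U : X.Opens, x ∈ U ∧ ∃ e : Γ(L, U), IsFrame L e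

variable {L}

/-- A global section `W` of `L` is a non-zero-divisor if the induced homomorphism of sheaves
`𝒪_X ⟶ L`, `r ↦ r • W`, is injective. -/
def IsNonZeroDivisorSection (W : Γ(L, ⊤)) : Prop :=
  ∀ (U : X.Opens), Function.Injective (fun r : Γ(X, U) => r • res L (le_top : U ≤ ⊤) W)

lemma res_res {U V V' : X.Opens} (h : V ≤ U) (h' : V' ≤ V) (s : Γ(L, U)) :
    res L h' (res L h s) = res L (h'.trans h) s := by
  unfold res
  rw [← ConcreteCategory.comp_apply, ← Functor.map_comp]
  rfl

lemma resO_resO {U V V' : X.Opens} (h : V ≤ U) (h' : V' ≤ V) (s : Γ(X, U)) :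
    resO h' (resO h s) = resO (h'.trans h) s := by
  unfold resO
  rw [← ConcreteCategory.comp_apply, ← Functor.map_comp]
  rfl

lemma res_smul {U V : X.Opens} (h : V ≤ U) (r : Γ(X, U)) (s : Γ(L, U)) :
    res L h (r • s) = resO h r • res L h s :=
  Scheme.Modules.map_smul L (homOfLE h) r s

lemma resO_mul {U V : X.Opens} (h : V ≤ U) (r s : Γ(X, U)) :
    resO h (r * s) = resO h r * resO h s := map_mul _ _ _

lemma resO_add {U V : X.Opens} (h : V ≤ U) (r s : Γ(X, U)) :
    resO h (r + s) = resO h r + resO h s := map_add _ _ _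

lemma resO_pow {U V : X.Opens} (h : V ≤ U) (r : Γ(X, U)) (n : ℕ) :
    resO h (r ^ n) = resO h r ^ n := map_pow _ _ _

lemma IsFrame.res {U V : X.Opens} {e : Γ(L, U)} (he : IsFrame L e) (h : V ≤ U) :
    IsFrame L (res L h e) := fun V' h' => by
  simpa only [res_res] using he V' (h'.trans h)

/-- The ideal of functions on `U` that are locally of the form `g * w`, where `W = w • e` in a
local frame `e` of `L`; this condition is written `f • e = g • W`. These are the sections over `U`
of the image of the homomorphism `L⁻¹ ⟶ 𝒪_X` given by `W`. -/
def zeroIdealAux (hL : IsInvertibleSheaf L) (W : Γ(L, ⊤)) (U : X.Opens) : Ideal Γ(X, U) where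
  carrier := {f | ∀ x ∈ U, ∃ (V : X.Opens) (hV : V ≤ U), x ∈ V ∧ ∃ e : Γ(L, V), IsFrame L e ∧
    ∃ g : Γ(X, V), resO hV f • e = g • res L (le_top : V ≤ ⊤) W}
  zero_mem' x hx := by
    obtain ⟨V, hxV, e, he⟩ := hL x
    refine ⟨V ⊓ U, inf_le_right, ⟨hxV, hx⟩, res L inf_le_left e, he.res _, 0, ?_⟩
    rw [show resO inf_le_right (0 : Γ(X, U)) = 0 from map_zero _, zero_smul, zero_smul]
  add_mem' {f f'} hf hf' x hx := by
    obtain ⟨V, hV, hxV, e, he, g, hg⟩ := hf x hx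
    obtain ⟨V', hV', hxV', e', he', g', hg'⟩ := hf' x hx
    obtain ⟨c, hc⟩ := (he' (V ⊓ V') inf_le_right).2 (res L inf_le_left e)
    have hg := congr_arg (res L (inf_le_left : V ⊓ V' ≤ V)) hg
    have hg' := congr_arg (res L (inf_le_right : V ⊓ V' ≤ V')) hg'
    simp only [res_smul, res_res, resO_resO] at hg hg'
    refine ⟨V ⊓ V', inf_le_left.trans hV, ⟨hxV, hxV'⟩, res L inf_le_left e, he.res _,
      resO inf_le_left g + c * resO inf_le_right g', ?_⟩
    rw [resO_add, add_smul, add_smul, hg, mul_smul, ← hg', ← hc, smul_smul, smul_smul, mul_comm]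
  smul_mem' r f hf x hx := by
    obtain ⟨V, hV, hxV, e, he, g, hg⟩ := hf x hx
    refine ⟨V, hV, hxV, e, he, resO hV r * g, ?_⟩
    rw [smul_eq_mul, resO_mul, mul_smul, mul_smul, hg]

variable (hL : IsInvertibleSheaf L) (W : Γ(L, ⊤))

lemma resO_mem_zeroIdealAux {U V : X.Opens} (h : V ≤ U) {f : Γ(X, U)}
    (hf : f ∈ zeroIdealAux hL W U) : resO h f ∈ zeroIdealAux hL W V := fun x hx => by
  obtain ⟨V', hV', hxV', e, he, g, hg⟩ := hf x (h hx)
  have hg := congr_arg (res L (inf_le_left : V' ⊓ V ≤ V')) hg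
  simp only [res_smul, res_res, resO_resO] at hg
  refine ⟨V' ⊓ V, inf_le_right, ⟨hxV', hx⟩, res L inf_le_left e, he.res _,
    resO inf_le_left g, ?_⟩
  rw [resO_resO, hg]

lemma mem_zeroIdealAux_of_locally {U : X.Opens} {f : Γ(X, U)}
    (hf : ∀ x ∈ U, ∃ (V : X.Opens) (hV : V ≤ U), x ∈ V ∧ resO hV f ∈ zeroIdealAux hL W V) :
    f ∈ zeroIdealAux hL W U := fun x hx => by
  obtain ⟨V, hV, hxV, h⟩ := hf x hx
  obtain ⟨V', hV', hxV', e, he, g, hg⟩ := h x hxV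
  exact ⟨V', hV'.trans hV, hxV', e, he, g, by rw [← hg, resO_resO]⟩

/-- Over an affine open set with a frame `e`, the ideal is generated by `w`, where `W = w • e`. -/
lemma zeroIdealAux_eq_span {V : X.Opens} (hV : IsAffineOpen V) {e : Γ(L, V)} (he : IsFrame L e)
    {w : Γ(X, V)} (hw : res L (le_top : V ≤ ⊤) W = w • e) :
    zeroIdealAux hL W V = Ideal.span {w} := by
  apply le_antisymm
  · intro h hh
    rw [hV.mem_ideal_iff]
    intro x hx
    obtain ⟨V', hV', hxV', e', he', g, hg⟩ := hh x hx
    obtain ⟨c, hc⟩ := (he' V' le_rfl).2 (res L hV' e)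
    have hre : res L (le_refl V') e' = e' := by
      unfold res
      rw [show (homOfLE (le_refl V')).op = 𝟙 (op V') from rfl, L.presheaf.map_id]
      rfl
    simp only [hre] at hc
    have hW := congr_arg (res L hV') hw
    simp only [res_smul, res_res] at hW
    have key : resO hV' h = c * g * resO hV' w := by
      apply (he V' hV').1
      simp only
      rw [mul_smul, ← hW, ← hc, smul_comm, hg, smul_smul]
    have : X.presheaf.germ V x hx h = X.presheaf.germ V' x hxV' (resO hV' h) :=
      (X.presheaf.germ_res_apply (homOfLE hV') x hxV' h).symm
    have hgw : X.presheaf.germ V x hx w = X.presheaf.germ V' x hxV' (resO hV' w) :=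
      (X.presheaf.germ_res_apply (homOfLE hV') x hxV' w).symm
    rw [this, key, map_mul, ← hgw]
    exact Ideal.mul_mem_left _ _ (Ideal.mem_map_of_mem _ (Ideal.mem_span_singleton_self w))
  · rw [Ideal.span_singleton_le_iff_mem]
    intro x hx
    refine ⟨V, le_rfl, hx, e, he, 1, ?_⟩
    rw [one_smul, hw]
    congr 1
    unfold resO
    rw [show (homOfLE (le_refl V)).op = 𝟙 (op V) from rfl, X.presheaf.map_id]
    rfl

/-- The ideal sheaf of the zero scheme of a section `W` of an invertible sheaf `L`: the image of
`L⁻¹ ⟶ 𝒪_X`, generated by `w` wherever `W = w • e` in a local frame `e` of `L`. -/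
def zeroIdeal : X.IdealSheafData where
  ideal U := zeroIdealAux hL W U.1
  map_ideal_basicOpen U f := by
    apply le_antisymm
    · refine Ideal.map_le_iff_le_comap.2 ?_
      intro a ha
      exact resO_mem_zeroIdealAux hL W (X.basicOpen_le f) ha
    intro h hh
    have hloc := U.2.isLocalization_basicOpen f
    obtain ⟨⟨a, ⟨_, k, rfl⟩⟩, hak⟩ := IsLocalization.surj (Submonoid.powers f) h
    have hak : h * resO (X.basicOpen_le f) f ^ k = resO (X.basicOpen_le f) a := by
      rw [← resO_pow]; exact hak
    have loc : ∀ x : U.1, ∃ (r : Γ(X, U.1)) (m : ℕ), x.1 ∈ X.basicOpen r ∧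
        resO (X.basicOpen_le r) (f ^ m * a) ∈ zeroIdealAux hL W (X.basicOpen r) := by
      rintro ⟨x, hx⟩
      obtain ⟨V, hxV, e, he⟩ := hL x
      obtain ⟨r, hrV, hxr⟩ := U.2.exists_basicOpen_le ⟨x, hxV⟩ hx
      have haff : IsAffineOpen (X.basicOpen r) := U.2.basicOpen r
      have he' := he.res hrV
      obtain ⟨w, hw⟩ := (he' _ le_rfl).2 (res L le_top W)
      simp only [res_res] at hw
      set fr := resO (X.basicOpen_le r) f with hfr
      have hloc' := haff.isLocalization_basicOpen fr
      have hle : X.basicOpen fr ≤ X.basicOpen f := by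
        rw [hfr, resO, Scheme.basicOpen_res]; exact inf_le_right
      have hm : resO (X.basicOpen_le fr) (resO (X.basicOpen_le r) a) ∈
          zeroIdealAux hL W (X.basicOpen fr) := by
        rw [resO_resO, ← resO_resO (X.basicOpen_le f) hle, ← hak]
        exact resO_mem_zeroIdealAux hL W hle (Ideal.mul_mem_right _ _ hh)
      rw [zeroIdealAux_eq_span hL W (haff.basicOpen fr) (he'.res (X.basicOpen_le fr))
        (w := resO (X.basicOpen_le fr) w)
        (by rw [← res_smul, hw, res_res])] at hm
      have hm' : algebraMap Γ(X, X.basicOpen r) Γ(X, X.basicOpen fr) (resO (X.basicOpen_le r) a) ∈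
          (Ideal.span {w}).map (algebraMap Γ(X, X.basicOpen r) Γ(X, X.basicOpen fr)) := by
        rw [Ideal.map_span, Set.image_singleton]; exact hm
      rw [IsLocalization.algebraMap_mem_map_algebraMap_iff (Submonoid.powers fr)] at hm'
      obtain ⟨_, ⟨m, rfl⟩, hm'⟩ := hm'
      refine ⟨r, m, hxr, ?_⟩
      rw [zeroIdealAux_eq_span hL W haff he' (w := w) (by rw [← hw]), resO_mul, resO_pow]
      exact hm'
    choose r m hxr hm using loc
    obtain ⟨t, ht⟩ := U.2.isCompact.elim_finite_subcover (fun x : U.1 => (X.basicOpen (r x) : Set X))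
      (fun x => (X.basicOpen (r x)).isOpen) (fun x hx => Set.mem_iUnion.2 ⟨⟨x, hx⟩, hxr ⟨x, hx⟩⟩)
    have hM : f ^ (t.sup m) * a ∈ zeroIdealAux hL W U.1 := by
      apply mem_zeroIdealAux_of_locally
      intro x hx
      obtain ⟨y, hy, hxy⟩ := Set.mem_iUnion₂.1 (ht hx)
      refine ⟨X.basicOpen (r y), X.basicOpen_le _, hxy, ?_⟩
      obtain ⟨d, hd⟩ := Nat.exists_eq_add_of_le (Finset.le_sup hy : m y ≤ t.sup m)
      rw [hd, pow_add, mul_comm (f ^ m y), mul_assoc, resO_mul]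
      exact Ideal.mul_mem_left _ _ (hm y)
    have := Ideal.mem_map_of_mem (X.presheaf.map (homOfLE <| X.basicOpen_le f).op).hom hM
    have hu : IsUnit (resO (X.basicOpen_le f) f) :=
      IsLocalization.Away.algebraMap_isUnit (S := Γ(X, X.basicOpen f)) f
    refine (Ideal.unit_mul_mem_iff_mem _ (hu.pow (t.sup m + k))).1 ?_
    convert this using 1
    change _ = resO (X.basicOpen_le f) (f ^ (t.sup m) * a)
    rw [resO_mul, ← hak, resO_pow]
    ring

/-- The zero scheme `X₀` of a section `W` of an invertible sheaf on `X`. -/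
abbrev zeroScheme : Scheme.{u} := (zeroIdeal hL W).subscheme

/-- The closed immersion `X₀ ⟶ X` of the zero scheme. -/
abbrev zeroSchemeι : zeroScheme hL W ⟶ X := (zeroIdeal hL W).subschemeι

end ZeroScheme

/-! ### Perfect modules and the locally relative singular locus -/

/-- A module `M` over a commutative ring `R` is perfect if, as an object of the derived category of
`R`-modules concentrated in degree `0`, it is isomorphic to a bounded complex of finitely generated
projective modules. -/
def IsPerfect {R : Type u} [CommRing R] (M : ModuleCat.{u} R) : Prop :=
  letI := HasDerivedCategory.standard (ModuleCat.{u} R)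
  ∃ P : CochainComplex (ModuleCat.{u} R) ℤ,
    (∃ a b : ℤ, P.IsStrictlyGE a ∧ P.IsStrictlyLE b) ∧
    (∀ n : ℤ, Module.Finite R (P.X n) ∧ Module.Projective R (P.X n)) ∧
    Nonempty (DerivedCategory.Q.obj P ≅
      DerivedCategory.Q.obj ((CochainComplex.singleFunctor (ModuleCat.{u} R) 0).obj M))

/-- The singular locus of `T` locally relative to `S`, for a closed immersion `i : T ⟶ S` of
Noetherian schemes: the points `p` of `T` for which there is a finitely generated `𝒪_{T,p}`-module
that is not perfect over `𝒪_{T,p}`, but whose restriction of scalars along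
`𝒪_{S,i(p)} ⟶ 𝒪_{T,p}` is perfect over `𝒪_{S,i(p)}`. -/
def singLoc {T S : Scheme.{u}} (i : T ⟶ S) [IsClosedImmersion i] : Set T :=
  {p | ∃ M : ModuleCat.{u} (T.presheaf.stalk p), Module.Finite (T.presheaf.stalk p) M ∧
    ¬ IsPerfect M ∧ IsPerfect ((ModuleCat.restrictScalars (i.stalkMap p).hom).obj M)}

/-! ### Codimension of a local ring -/

/-- The embedding dimension of a local ring. -/
def embDim (R : Type u) [CommRing R] [IsLocalRing R] : ℕ :=
  Module.finrank (IsLocalRing.ResidueField R) (IsLocalRing.CotangentSpace R)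

/-- The codimension `emb.dim(R) - dim(R)` of a Noetherian local ring, whose Krull dimension is a
natural number. -/
def codim (R : Type u) [CommRing R] [IsLocalRing R] : ℤ :=
  (embDim R : ℤ) - (((ringKrullDim R).unbotD 0).toNat : ℤ)

end RelSing

end

/-! The question is local. At `p` put `R` for the stalk of `X` and `S` for that of `X₀`; then `S =
R/w` with `w` a nonzerodivisor in the maximal ideal `m` of `R` (`germ_mem_nonZeroDivisors`,
`ker_stalkMap_zeroSchemeι`). Both sides of the equality turn out to say `w ∈ m ^ 2`.

Since `dim R = dim S + 1`, the codimension grows exactly when the embedding dimension does not drop.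
The kernel of `m_R/m_R² → m_S/m_S²` is generated by the class of `w`, so this means `w ∈ m ^ 2`
(`codim_lt_codim_quotient_iff`).

For finite modules over a Noetherian ring, perfect means of finite projective dimension
(`isPerfect_iff`). If `w ∉ m ^ 2`, finite projective dimension over `R` descends to `S`: syzygies
over `S` reduce to dimension at most one over `R`, where a minimal cover `R^n → M` has kernel
exactly `w R^n`, so that `M` is free over `S` (`projDimLT_quotient`). If `w ∈ m ^ 2`, then `w` has a
matrix factorization with entries in `m`; its cokernel has a free resolution of length one over `R`,
but a minimal two-periodic, hence infinite, one over `S` (`exists_not_projDimLT`). -/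

noncomputable section

namespace RelSing

/-! ### Perfect modules and projective dimension -/

section Perfect

open CategoryTheory.Limits Pretriangulated

universe w v

variable {C : Type*} [Category.{v} C] [Abelian C]

/-- Morphisms in the derived category out of a K-projective complex are induced by morphisms of complexes. -/
lemma exists_Q_map_eq [HasDerivedCategory.{w} C] (K L : CochainComplex C ℤ) [K.IsKProjective]
    (f : DerivedCategory.Q.obj K ⟶ DerivedCategory.Q.obj L) :
    ∃ g : K ⟶ L, DerivedCategory.Q.map g = f := by
  obtain ⟨g', hg'⟩ := (CochainComplex.IsKProjective.Qh_map_bijective K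
    ((HomotopyCategory.quotient C (.up ℤ)).obj L)).surjective
      ((DerivedCategory.quotientCompQhIso C).hom.app K ≫ f ≫
        (DerivedCategory.quotientCompQhIso C).inv.app L)
  obtain ⟨g, rfl⟩ := (HomotopyCategory.quotient C (.up ℤ)).map_surjective g'
  refine ⟨g, ?_⟩
  have h := DerivedCategory.quotientCompQhIso_hom_naturality g
  rw [hg'] at h
  simpa using h.symm

/-- An object quasi-isomorphic to a bounded complex of projectives has finite projective
dimension. -/
lemma hasProjectiveDimensionLT_of_iso_Q [HasDerivedCategory.{w} C] (P : CochainComplex C ℤ)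
    (n : ℕ) (b : ℤ) [P.IsStrictlyGE (-n + 1)] [P.IsStrictlyLE b] [∀ i, Projective (P.X i)] (M : C)
    (e : DerivedCategory.Q.obj P ≅
      DerivedCategory.Q.obj ((CochainComplex.singleFunctor C 0).obj M)) :
    HasProjectiveDimensionLT M n := by
  have := HasExt.standard C
  have := CochainComplex.isKProjective_of_projective P b
  rw [hasProjectiveDimensionLT_iff]
  intro i hi Y x
  apply Abelian.Ext.ext
  rw [Abelian.Ext.zero_hom]
  generalize x.hom = f
  change DerivedCategory.Q.obj ((CochainComplex.singleFunctor C 0).obj M) ⟶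
    (DerivedCategory.Q.obj ((CochainComplex.singleFunctor C 0).obj Y))⟦(i : ℤ)⟧ at f
  obtain ⟨g, hg⟩ := exists_Q_map_eq P (((CochainComplex.singleFunctor C 0).obj Y)⟦(i : ℤ)⟧)
    (e.hom ≫ f ≫ (DerivedCategory.Q.commShiftIso (i : ℤ)).inv.app _)
  -- `P` lives in degrees `> -n`, while the shifted single complex lives in degree `-i ≤ -n`.
  have hg0 : g = 0 := by
    ext j
    by_cases hj : j + i = 0
    · exact (P.isZero_of_isStrictlyGE (-n + 1) j).eq_of_src _ _
    · have : IsZero ((((CochainComplex.singleFunctor C 0).obj Y)⟦(i : ℤ)⟧).X j) :=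
        HomologicalComplex.isZero_single_obj_X (.up ℤ) 0 Y (j + i) hj
      exact this.eq_of_tgt _ _
  rw [hg0, Functor.map_zero] at hg
  have h2 := congr_arg (fun t => e.inv ≫ t ≫
    (DerivedCategory.Q.commShiftIso (i : ℤ)).hom.app _) hg
  simp only [Iso.inv_hom_id_assoc, Category.assoc, Iso.inv_hom_id_app, zero_comp, comp_zero] at h2
  exact (Category.comp_id f).symm.trans h2.symm

variable {R : Type u} [CommRing R]

lemma IsPerfect.exists_hasProjectiveDimensionLT {M : ModuleCat.{u} R} (hM : IsPerfect M) :
    ∃ n, HasProjectiveDimensionLT M n := by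
  let := HasDerivedCategory.standard (ModuleCat.{u} R)
  obtain ⟨P, ⟨a, b, ha, hb⟩, hP, ⟨e⟩⟩ := hM
  have (i : ℤ) : Projective (P.X i) :=
    (IsProjective.iff_projective (R := R) (P.X i)).1 (hP i).2
  -- The truncation is harmless: if `a > 1` the bound becomes `1 ≤ a`.
  have : P.IsStrictlyGE (-((1 - a).toNat : ℤ) + 1) :=
    P.isStrictlyGE_of_ge _ a (by omega)
  exact ⟨(1 - a).toNat, hasProjectiveDimensionLT_of_iso_Q P _ b M e⟩

lemma isPerfect_of_projective (M : ModuleCat.{u} R) [Module.Finite R M] [Module.Projective R M] :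
    IsPerfect M := by
  let := HasDerivedCategory.standard (ModuleCat.{u} R)
  refine ⟨(CochainComplex.singleFunctor (ModuleCat.{u} R) 0).obj M,
    ⟨0, 0, inferInstance, inferInstance⟩, fun n => ?_, ⟨Iso.refl _⟩⟩
  by_cases hn : n = 0
  · subst hn
    let e := (HomologicalComplex.singleObjXSelf (.up ℤ) 0 M).toLinearEquiv
    exact ⟨Module.Finite.equiv e.symm, Module.Projective.of_equiv e.symm⟩
  · have hz : IsZero (((CochainComplex.singleFunctor (ModuleCat.{u} R) 0).obj M).X n) :=
      HomologicalComplex.isZero_single_obj_X (.up ℤ) 0 M n hn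
    have := ModuleCat.subsingleton_of_isZero hz
    exact ⟨inferInstance, inferInstance⟩

/-- In a short exact sequence, the third term is perfect if the first two are. -/
lemma IsPerfect.of_shortExact {S : ShortComplex (ModuleCat.{u} R)} (hS : S.ShortExact)
    (h₁ : IsPerfect S.X₁) (h₂ : IsPerfect S.X₂) : IsPerfect S.X₃ := by
  let := HasDerivedCategory.standard (ModuleCat.{u} R)
  obtain ⟨P, ⟨a, b, ha, hb⟩, hP, ⟨e⟩⟩ := h₁
  obtain ⟨P', ⟨a', b', ha', hb'⟩, hP', ⟨e'⟩⟩ := h₂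
  have (i : ℤ) : Projective (P.X i) :=
    (IsProjective.iff_projective (R := R) (P.X i)).1 (hP i).2
  have := CochainComplex.isKProjective_of_projective P b
  have hS' := hS.map_of_exact (HomologicalComplex.single (ModuleCat.{u} R) (ComplexShape.up ℤ) 0)
  have hT := DerivedCategory.triangleOfSES_distinguished hS'
  -- The K-projectivity of `P` lifts the first map of the sequence to a chain map; its mapping cone
  -- then represents the third term.
  obtain ⟨φ, hφ⟩ := exists_Q_map_eq P P' (e.hom ≫ (DerivedCategory.triangleOfSES hS').mor₁ ≫ e'.inv)
  have hX (n : ℤ) : (CochainComplex.mappingCone φ).X n ≅ P.X (n + 1) ⊞ P'.X n :=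
    HomologicalComplex.homotopyCofiber.XIsoBiprod φ n (n + 1) (by simp)
  let eX (n : ℤ) := ((hX n) ≪≫ ModuleCat.biprodIsoProd _ _).toLinearEquiv
  have hT' := DerivedCategory.mappingCone_triangle_distinguished φ
  refine ⟨CochainComplex.mappingCone φ, ⟨min (a - 1) a', max b b', ?_, ?_⟩, fun n => ?_, ?_⟩
  · rw [CochainComplex.isStrictlyGE_iff]
    intro i hi
    exact ((hX i).isZero_iff).2 (by
      rw [biprod_isZero_iff]
      exact ⟨P.isZero_of_isStrictlyGE a _, P'.isZero_of_isStrictlyGE a' _⟩)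
  · rw [CochainComplex.isStrictlyLE_iff]
    intro i hi
    exact ((hX i).isZero_iff).2 (by
      rw [biprod_isZero_iff]
      exact ⟨P.isZero_of_isStrictlyLE b _, P'.isZero_of_isStrictlyLE b' _⟩)
  · obtain ⟨_, _⟩ := hP (n + 1)
    obtain ⟨_, _⟩ := hP' n
    exact ⟨Module.Finite.equiv (eX n).symm, Module.Projective.of_equiv (eX n).symm⟩
  · exact ⟨Triangle.π₃.mapIso (isoTriangleOfIso₁₂ _ _ hT' hT e e' (by
      change DerivedCategory.Q.map φ ≫ e'.hom = e.hom ≫ _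
      rw [hφ, Category.assoc]
      exact congr_arg (e.hom ≫ ·)
        ((Category.assoc _ _ _).trans ((congr_arg (_ ≫ ·) e'.inv_hom_id).trans (Category.comp_id _)))))⟩

/-- The short complex of modules attached to an exact pair of linear maps. -/
abbrev shortComplexOfExact {A B D : Type u} [AddCommGroup A] [AddCommGroup B] [AddCommGroup D]
    [Module R A] [Module R B] [Module R D] {f : A →ₗ[R] B} {g : B →ₗ[R] D}
    (h : Function.Exact f g) : ShortComplex (ModuleCat.{u} R) :=
  ShortComplex.mk (ModuleCat.ofHom f) (ModuleCat.ofHom g) (by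
    ext x; exact h.apply_apply_eq_zero x)

section Modules

variable {A B D : Type u} [AddCommGroup A] [AddCommGroup B] [AddCommGroup D]
    [Module R A] [Module R B] [Module R D] {f : A →ₗ[R] B} {g : B →ₗ[R] D}

lemma shortExact_shortComplexOfExact (hf : Function.Injective f) (h : Function.Exact f g)
    (hg : Function.Surjective g) : (shortComplexOfExact h).ShortExact where
  exact := (ShortComplex.ShortExact.moduleCat_exact_iff_function_exact _).2 h
  mono_f := (ModuleCat.mono_iff_injective _).2 hf
  epi_g := (ModuleCat.epi_iff_surjective _).2 hg

variable (R) in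
/-- The module `M` has projective dimension `< n`. -/
abbrev ProjDimLT (M : Type u) [AddCommGroup M] [Module R M] (n : ℕ) : Prop :=
  HasProjectiveDimensionLT (ModuleCat.of R M) n

lemma ProjDimLT.mono {n m : ℕ} (h : ProjDimLT R A n) (hnm : n ≤ m) : ProjDimLT R A m :=
  hasProjectiveDimensionLT_of_ge _ n m hnm

lemma projDimLT_one_iff : ProjDimLT R A 1 ↔ Module.Projective R A := by
  rw [ProjDimLT, ← projective_iff_hasProjectiveDimensionLT_one]
  exact (IsProjective.iff_projective (R := R) A).symm

lemma ProjDimLT.kernel {n : ℕ} (hf : Function.Injective f) (h : Function.Exact f g)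
    (hg : Function.Surjective g) (hB : ProjDimLT R B n) (hD : ProjDimLT R D (n + 1)) :
    ProjDimLT R A n :=
  (shortExact_shortComplexOfExact hf h hg).hasProjectiveDimensionLT_X₁ n hB hD

lemma ProjDimLT.cokernel {n : ℕ} (hf : Function.Injective f) (h : Function.Exact f g)
    (hg : Function.Surjective g) (hA : ProjDimLT R A n) (hB : ProjDimLT R B (n + 1)) :
    ProjDimLT R D (n + 1) :=
  (shortExact_shortComplexOfExact hf h hg).hasProjectiveDimensionLT_X₃ n hA hB

end Modules

/-- Induction along first syzygies, which stay finite because `R` is Noetherian. -/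
lemma isPerfect_of_projDimLT [IsNoetherianRing R] (n : ℕ) (M : Type u) [AddCommGroup M]
    [Module R M] [Module.Finite R M] (hM : ProjDimLT R M (n + 1)) :
    IsPerfect (ModuleCat.of R M) := by
  induction n generalizing M with
  | zero =>
    have : Module.Projective R M := projDimLT_one_iff.1 hM
    exact isPerfect_of_projective _
  | succ n ih =>
    obtain ⟨m, f, hf⟩ := Module.Finite.exists_fin' R M
    have hS := shortExact_shortComplexOfExact (LinearMap.ker f).subtype_injective
      f.exact_subtype_ker_map hf
    refine IsPerfect.of_shortExact hS (ih _ ?_) (isPerfect_of_projective _)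
    exact ProjDimLT.kernel (LinearMap.ker f).subtype_injective f.exact_subtype_ker_map hf
      ((projDimLT_one_iff.2 inferInstance).mono (by omega)) hM

/-- A finite module over a Noetherian ring is perfect if and only if it has finite projective
dimension. -/
lemma isPerfect_iff [IsNoetherianRing R] (M : Type u) [AddCommGroup M] [Module R M]
    [Module.Finite R M] : IsPerfect (ModuleCat.of R M) ↔ ∃ n, ProjDimLT R M n := by
  refine ⟨IsPerfect.exists_hasProjectiveDimensionLT, fun ⟨n, hn⟩ => ?_⟩
  exact isPerfect_of_projDimLT n M (hn.mono (by omega))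

end Perfect

/-! ### Descent of finite projective dimension to a hypersurface -/

section LocalAlgebra

open IsLocalRing TensorProduct

section MinimalCover

variable {R : Type*} [CommRing R] [IsLocalRing R]

/-- A finite module over a local ring has a minimal free cover. -/
lemma exists_minimal_cover (M : Type*) [AddCommGroup M] [Module R M] [Module.Finite R M] :
    ∃ (n : ℕ) (f : (Fin n → R) →ₗ[R] M), Function.Surjective f ∧
      ∀ x, f x = 0 → ∀ i, x i ∈ maximalIdeal R := by
  -- Lift a basis of `k ⊗ M`: Nakayama gives surjectivity, and independence over `k` puts the
  -- coefficients of every relation in the maximal ideal.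
  let b := Module.finBasis (ResidueField R) (ResidueField R ⊗[R] M)
  obtain ⟨v, hv⟩ := (TensorProduct.mk_surjective R M (ResidueField R)
    residue_surjective).comp_left b
  have hv' (i) : (1 : ResidueField R) ⊗ₜ[R] v i = b i := congr_fun hv i
  refine ⟨_, Fintype.linearCombination R v, ?_, fun x hx i => ?_⟩
  · rw [← LinearMap.range_eq_top, Fintype.range_linearCombination]
    exact span_eq_top_of_tmul_eq_basis _ b hv'
  · have h : ∑ i, residue R (x i) • b i = 0 := by
      have := congr_arg (TensorProduct.mk R (ResidueField R) M 1) hx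
      rw [Fintype.linearCombination_apply, map_sum, map_zero] at this
      rw [← this]
      refine Finset.sum_congr rfl fun j _ => ?_
      rw [map_smul, TensorProduct.mk_apply, hv' j]
      exact algebraMap_smul (ResidueField R) (x j) (b j)
    rw [← residue_eq_zero_iff]
    exact Fintype.linearIndependent_iff.1 b.linearIndependent _ h i

lemma repr_mem_maximalIdeal_of_one_tmul_eq_zero {ι N : Type*} [AddCommGroup N] [Module R N]
    (b : Module.Basis ι R N) {y : N} (hy : (1 : ResidueField R) ⊗ₜ[R] y = 0) (i : ι) :
    b.repr y i ∈ maximalIdeal R := by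
  rw [← residue_eq_zero_iff]
  have := congr_arg (fun z => (b.baseChange (ResidueField R)).repr z i) hy
  simpa [Module.Basis.baseChange_repr_tmul, Algebra.smul_def] using this

end MinimalCover

variable {R S : Type u} [CommRing R] [CommRing S] [Algebra R S]

section Hypersurface

variable {w : R} (hS : Function.Surjective (algebraMap R S))
  (hker : RingHom.ker (algebraMap R S) = Ideal.span {w})

include hker in
lemma algebraMap_eq_zero_iff_dvd (r : R) : algebraMap R S r = 0 ↔ w ∣ r := by
  rw [← RingHom.mem_ker, hker, Ideal.mem_span_singleton]

include hker in
lemma comp_eq_zero_iff {ι : Type*} (x : ι → R) : algebraMap R S ∘ x = 0 ↔ ∃ y, x = w • y := by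
  constructor
  · intro h
    have h' (i) : w ∣ x i := (algebraMap_eq_zero_iff_dvd hker _).1 (congr_fun h i)
    choose y hy using h'
    exact ⟨y, funext hy⟩
  · rintro ⟨y, rfl⟩
    ext i
    exact (algebraMap_eq_zero_iff_dvd hker _).2 (Dvd.intro _ rfl)

include hS hker in
-- The resolution is multiplication by `w` on `R^ι`.
lemma projDimLT_two_pi (hw : w ∈ nonZeroDivisors R) (ι : Type) [Finite ι] :
    ProjDimLT R (ι → S) 2 := by
  have hfree : ProjDimLT R (ι → R) 1 := projDimLT_one_iff.2 inferInstance
  refine ProjDimLT.cokernel (f := w • LinearMap.id) (g := (Algebra.linearMap R S).compLeft ι)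
    ?_ ?_ ?_ hfree (hfree.mono one_le_two)
  · intro x y h
    ext i
    exact (mul_cancel_left_mem_nonZeroDivisors hw).1 (congr_fun h i)
  · intro x
    refine (comp_eq_zero_iff hker x).trans ?_
    exact exists_congr fun y => eq_comm
  · exact hS.comp_left

variable [IsLocalRing R] [IsNoetherianRing R]

variable {M : Type u} [AddCommGroup M] [Module R M] [Module S M] [IsScalarTower R S M]

include hS hker in
/-- A finite `R/w`-module of projective dimension at most one over `R` is projective over `R/w`
if `w` is outside the square of the maximal ideal. -/
lemma projective_of_projDimLT_two (hwm : w ∉ maximalIdeal R ^ 2)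
    [Module.Finite R M] (hM : ProjDimLT R M 2) : Module.Projective S M := by
  obtain ⟨n, f, hf, hmin⟩ := exists_minimal_cover (R := R) M
  have hwM (y : M) : w • y = 0 := by
    rw [← algebraMap_smul S, (algebraMap_eq_zero_iff_dvd hker w).2 dvd_rfl, zero_smul]
  let N := LinearMap.ker f
  have : Module.Projective R N := projDimLT_one_iff.1 <|
    ProjDimLT.kernel N.subtype_injective f.exact_subtype_ker_map hf
      (projDimLT_one_iff.2 inferInstance) hM
  have : Module.Free R N := Module.free_of_flat_of_isLocalRing
  -- Multiplication by `w` lands in `N` because `w` kills `M`. It is split injective as soon as it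
  -- is injective modulo the maximal ideal.
  let l : (Fin n → R) →ₗ[R] N := (w • LinearMap.id).codRestrict N fun x => by
    simp [N, hwM]
  have hl : Function.Injective (l.lTensor (ResidueField R)) := by
    rw [injective_iff_map_eq_zero]
    intro z hz
    obtain ⟨x, rfl⟩ := TensorProduct.mk_surjective R (Fin n → R) (ResidueField R)
      residue_surjective z
    rw [TensorProduct.mk_apply, LinearMap.lTensor_tmul] at hz
    let b := Module.Free.chooseBasis R N
    have hb := repr_mem_maximalIdeal_of_one_tmul_eq_zero b hz
    -- Here `w x ∈ m N` and `N ⊆ m R^n` by minimality, so `w * x i ∈ m ^ 2`; a unit `x i` would put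
    -- `w` in `m ^ 2`.
    have hx (i) : x i ∈ maximalIdeal R := by
      by_contra hxi
      rw [mem_maximalIdeal, mem_nonunits_iff, not_not] at hxi
      apply hwm
      rw [← Ideal.mul_unit_mem_iff_mem _ hxi, pow_two]
      have h1 : w * x i = (l x : Fin n → R) i := rfl
      rw [h1, ← b.sum_repr (l x), Submodule.coe_sum, Finset.sum_apply]
      exact Ideal.sum_mem _ fun j _ => Ideal.mul_mem_mul (hb j) (hmin _ (b j).2 i)
    rw [TensorProduct.mk_apply, pi_eq_sum_univ' x, TensorProduct.tmul_sum]
    refine Finset.sum_eq_zero fun i _ => ?_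
    rw [TensorProduct.tmul_smul, TensorProduct.smul_tmul',
      Algebra.smul_def, ResidueField.algebraMap_eq, (residue_eq_zero_iff _).2 (hx i), zero_mul,
      TensorProduct.zero_tmul]
  obtain ⟨π, hπ⟩ := (split_injective_iff_lTensor_residueField_injective l).2 hl
  -- For `x ∈ N`, applying the retraction to `l x = w • x` gives `x = w • π x`; hence `N = w R^n`.
  have hN (x : Fin n → R) (hx : f x = 0) : ∃ y, x = w • y := by
    refine ⟨π ⟨x, hx⟩, ?_⟩
    have : l x = w • ⟨x, hx⟩ := rfl
    rw [← map_smul, ← this]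
    exact (LinearMap.congr_fun hπ x).symm
  let v : Fin n → M := fun i => f (Pi.single i 1)
  have hfv (x : Fin n → R) : f x = ∑ i, x i • v i := by
    conv_lhs => rw [pi_eq_sum_univ' x]
    simp [v]
  have hli : LinearIndependent S v := by
    rw [Fintype.linearIndependent_iff]
    intro g hg i
    obtain ⟨x, rfl⟩ := hS.comp_left g
    obtain ⟨y, hy⟩ := hN x (by simpa [hfv] using hg)
    change algebraMap R S (x i) = 0
    rw [algebraMap_eq_zero_iff_dvd hker, hy]
    exact Dvd.intro _ rfl
  have hsp : ⊤ ≤ Submodule.span S (Set.range v) := by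
    rintro m -
    obtain ⟨x, rfl⟩ := hf m
    rw [hfv]
    exact Submodule.sum_mem _ fun i _ => by
      rw [← algebraMap_smul S]
      exact Submodule.smul_mem _ _ (Submodule.subset_span ⟨i, rfl⟩)
  exact Module.Projective.of_basis (Module.Basis.mk hli hsp)

include hS hker in
/-- If `w` is a nonzerodivisor outside the square of the maximal ideal, then finite
`R/w`-modules of finite projective dimension over `R` have finite projective dimension
over `R/w`. -/
lemma projDimLT_quotient (hw : w ∈ nonZeroDivisors R) (hwm : w ∉ maximalIdeal R ^ 2)
    [Module.Finite S M] (n : ℕ) (hM : ProjDimLT R M (n + 2)) : ProjDimLT S M (n + 1) := by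
  have : Module.Finite R S := Module.Finite.of_surjective (Algebra.linearMap R S) hS
  induction n generalizing M with
  | zero =>
    have : Module.Finite R M := Module.Finite.trans S M
    exact projDimLT_one_iff.2 (projective_of_projDimLT_two hS hker hwm hM)
  | succ n ih =>
    have : IsNoetherianRing S := isNoetherianRing_of_surjective R S _ hS
    obtain ⟨m, g, hg⟩ := Module.Finite.exists_fin' S M
    refine ProjDimLT.cokernel (LinearMap.ker g).subtype_injective g.exact_subtype_ker_map hg
      (ih ?_) ((projDimLT_one_iff.2 inferInstance).mono (by omega))
    -- Passing to a syzygy over `S` also lowers the dimension over `R`, since `S^m` has dimension at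
    -- most one there.
    exact ProjDimLT.kernel (f := (LinearMap.ker g).subtype.restrictScalars R)
      (g := g.restrictScalars R) (LinearMap.ker g).subtype_injective g.exact_subtype_ker_map hg
      ((projDimLT_two_pi hS hker hw (Fin m)).mono (by omega)) hM

end Hypersurface

end LocalAlgebra

/-! ### Matrix factorizations and two-periodic resolutions -/

section MatrixFactorization

open IsLocalRing

/-- A nonempty matrix factorization of `x` with entries in an ideal `I`. -/
def HasMatrixFactorization {R : Type*} [CommRing R] (I : Ideal R) (x : R) : Prop :=
  ∃ (ι : Type) (_ : Fintype ι) (_ : DecidableEq ι) (_ : Nonempty ι) (A B : Matrix ι ι R),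
    (∀ i j, A i j ∈ I) ∧ (∀ i j, B i j ∈ I) ∧ A * B = x • 1 ∧ B * A = x • 1

/-- Every element of `I ^ 2` has a nonempty matrix factorization with entries in `I`. -/
lemma hasMatrixFactorization_of_mem_sq {R : Type*} [CommRing R] {I : Ideal R} {x : R}
    (hx : x ∈ I ^ 2) : HasMatrixFactorization I x := by
  -- Strengthened so that the products summing to `x` can be absorbed one at a time, starting from
  -- the 1×1 zero factorization of `0`.
  have key : ∀ z, HasMatrixFactorization I z → HasMatrixFactorization I (z + x) := by
    rw [pow_two] at hx
    induction hx using Submodule.mul_induction_on' with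
    | mem_mul_mem a ha b hb =>
      rintro z ⟨ι, _, _, _, A, B, hA, hB, hAB, hBA⟩
      have hone (c : R) (hc : c ∈ I) (i j : ι) : (c • (1 : Matrix ι ι R)) i j ∈ I := by
        rw [Matrix.smul_apply, smul_eq_mul]
        exact I.mul_mem_right _ hc
      have hadd : (Matrix.fromBlocks ((z + a * b) • (1 : Matrix ι ι R)) 0 0
          ((z + a * b) • 1)) = (z + a * b) • (1 : Matrix (ι ⊕ ι) (ι ⊕ ι) R) := by
        rw [← Matrix.fromBlocks_one, Matrix.fromBlocks_smul, smul_zero]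
      refine ⟨ι ⊕ ι, inferInstance, inferInstance, inferInstance,
        Matrix.fromBlocks A (-(b • 1)) (a • 1) B, Matrix.fromBlocks B (b • 1) (-(a • 1)) A,
        ?_, ?_, ?_, ?_⟩
      · rintro (i | i) (j | j)
        · exact hA i j
        · exact I.neg_mem (hone b hb i j)
        · exact hone a ha i j
        · exact hB i j
      · rintro (i | i) (j | j)
        · exact hB i j
        · exact hone b hb i j
        · exact I.neg_mem (hone a ha i j)
        · exact hA i j
      · rw [Matrix.fromBlocks_multiply, ← hadd]
        congr 1 <;> simp [hAB, hBA, add_smul, smul_smul, mul_comm, add_comm]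
      · rw [Matrix.fromBlocks_multiply, ← hadd]
        congr 1 <;> simp [hAB, hBA, add_smul, smul_smul, mul_comm, add_comm]
    | add y _ y' _ ih ih' =>
      intro z hz
      rw [← add_assoc]
      exact ih' _ (ih _ hz)
  rw [← zero_add x]
  refine key 0 ⟨Unit, inferInstance, inferInstance, inferInstance, 0, 0, ?_, ?_, ?_, ?_⟩ <;> simp

/-- The cokernel of a map in a minimal two-periodic exact sequence over a local ring has infinite
projective dimension. -/
lemma not_projDimLT_of_exact {S V : Type u} [CommRing S] [IsLocalRing S] [AddCommGroup V]
    [Module S V] [Module.Finite S V] [Module.Projective S V] [IsNoetherianRing S] [Nontrivial V]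
    (n : ℕ) (a b : V →ₗ[S] V)
    (hab : Function.Exact a b) (hba : Function.Exact b a)
    (ha : LinearMap.range a ≤ maximalIdeal S • ⊤) (hb : LinearMap.range b ≤ maximalIdeal S • ⊤) :
    ¬ ProjDimLT S (V ⧸ LinearMap.range a) (n + 1) := by
  have hjac : maximalIdeal S ≤ Ideal.jacobson ⊥ := maximalIdeal_le_jacobson _
  induction n generalizing a b with
  | zero =>
    intro h
    have : Module.Projective S (V ⧸ LinearMap.range a) := projDimLT_one_iff.1 h
    obtain ⟨s, hs⟩ := Module.projective_lifting_property (LinearMap.range a).mkQ LinearMap.id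
      (Submodule.mkQ_surjective _)
    -- The splitting makes `p` a projection onto `range a`. As `range a ⊆ m V`, applying `p` gives
    -- `range a ⊆ m (range a)`, and Nakayama forces `a = 0`.
    let p : V →ₗ[S] V := LinearMap.id - s ∘ₗ (LinearMap.range a).mkQ
    have hp (x : V) : p x ∈ LinearMap.range a := by
      rw [← Submodule.ker_mkQ (LinearMap.range a), LinearMap.mem_ker]
      have := LinearMap.congr_fun hs ((LinearMap.range a).mkQ x)
      simp only [LinearMap.comp_apply, LinearMap.id_apply] at this
      simp only [p, LinearMap.sub_apply, map_sub, LinearMap.comp_apply, LinearMap.id_apply, this,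
        sub_self]
    have hp' (x : V) (hx : x ∈ LinearMap.range a) : p x = x := by
      have : (LinearMap.range a).mkQ x = 0 := by
        rwa [← LinearMap.mem_ker, Submodule.ker_mkQ]
      simp only [p, LinearMap.sub_apply, LinearMap.comp_apply, LinearMap.id_apply, this, map_zero,
        sub_zero]
    have ha0 : LinearMap.range a = ⊥ := by
      refine Submodule.eq_bot_of_le_smul_of_le_jacobson_bot (maximalIdeal S) _
        (IsNoetherian.noetherian _) ?_ hjac
      intro x hx
      have h1 : p x ∈ (maximalIdeal S • (⊤ : Submodule S V)).map p :=
        Submodule.mem_map_of_mem (ha hx)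
      rw [hp' x hx, Submodule.map_smul''] at h1
      refine Submodule.smul_mono le_rfl ?_ h1
      rintro _ ⟨y, -, rfl⟩
      exact hp y
    -- With `a = 0`, exactness gives `V = ker a = range b ⊆ m V`.
    have hV : (⊤ : Submodule S V) = ⊥ := by
      refine Submodule.eq_bot_of_le_smul_of_le_jacobson_bot (maximalIdeal S) _
        (IsNoetherian.noetherian _) ?_ hjac
      refine le_trans ?_ hb
      rw [← LinearMap.exact_iff.1 hba, LinearMap.range_eq_bot.1 ha0, LinearMap.ker_zero]
    exact top_ne_bot hV
  | succ n ih =>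
    intro h
    refine ih b a hba hab hb ha ?_
    have hker := LinearMap.exact_iff.1 hba
    -- The cokernel of `b` is `V / ker a ≅ range a`, the first syzygy of the cokernel of `a`.
    refine ProjDimLT.kernel (f := (LinearMap.range b).liftQ a hker.ge)
      (g := (LinearMap.range a).mkQ) ?_ ?_ (Submodule.mkQ_surjective _)
      ((projDimLT_one_iff.2 inferInstance).mono (by omega)) h
    · rw [← LinearMap.ker_eq_bot, Submodule.ker_liftQ_eq_bot _ _ _ hker.le]
    · rw [LinearMap.exact_iff, Submodule.ker_mkQ, Submodule.range_liftQ]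

variable {R S : Type u} [CommRing R] [CommRing S] [Algebra R S] {w : R}
  (hS : Function.Surjective (algebraMap R S))
  (hker : RingHom.ker (algebraMap R S) = Ideal.span {w})

section

variable {ι : Type} [Fintype ι]

lemma map_mulVec_comp (A : Matrix ι ι R) (x : ι → R) :
    (A.map (algebraMap R S)).mulVecLin (algebraMap R S ∘ x) = algebraMap R S ∘ A.mulVec x := by
  ext i
  exact (RingHom.map_mulVec (algebraMap R S) A x i).symm

lemma range_mulVecLin_le (I : Ideal S) {A : Matrix ι ι S} (hA : ∀ i j, A i j ∈ I) :
    LinearMap.range A.mulVecLin ≤ I • ⊤ := by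
  classical
  rintro _ ⟨x, rfl⟩
  rw [Matrix.mulVecLin_apply, pi_eq_sum_univ' (A.mulVec x)]
  refine Submodule.sum_mem _ fun i _ => Submodule.smul_mem_smul ?_ trivial
  exact Ideal.sum_mem _ fun j _ => I.mul_mem_right _ (hA i j)

variable [DecidableEq ι]

lemma mulVec_mulVec_of_mul_eq {A B : Matrix ι ι R} (h : A * B = w • 1) (x : ι → R) :
    A.mulVec (B.mulVec x) = w • x := by
  rw [Matrix.mulVec_mulVec, h, Matrix.smul_mulVec, Matrix.one_mulVec]

lemma mulVec_injective_of_mul_eq (hw : w ∈ nonZeroDivisors R) {A B : Matrix ι ι R}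
    (h : B * A = w • 1) : Function.Injective A.mulVec := by
  intro x y hxy
  have := congr_arg B.mulVec hxy
  rw [mulVec_mulVec_of_mul_eq h, mulVec_mulVec_of_mul_eq h] at this
  ext i
  exact (mul_cancel_left_mem_nonZeroDivisors hw).1 (congr_fun this i)

include hS hker in
-- If `B x = w y` over `R`, then `B x = B (A y)`, and `B` is injective because `A * B = w`.
lemma exact_map_mulVecLin (hw : w ∈ nonZeroDivisors R) {A B : Matrix ι ι R}
    (hAB : A * B = w • 1) (hBA : B * A = w • 1) :
    Function.Exact (A.map (algebraMap R S)).mulVecLin (B.map (algebraMap R S)).mulVecLin := by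
  intro z
  obtain ⟨x, rfl⟩ := hS.comp_left z
  constructor
  · intro h
    rw [map_mulVec_comp, comp_eq_zero_iff hker] at h
    obtain ⟨y, hy⟩ := h
    rw [← mulVec_mulVec_of_mul_eq hBA] at hy
    refine ⟨algebraMap R S ∘ y, ?_⟩
    rw [map_mulVec_comp, mulVec_injective_of_mul_eq hw hAB hy]
  · rintro ⟨z, hz⟩
    obtain ⟨y, rfl⟩ := hS.comp_left z
    rw [← hz, map_mulVec_comp, map_mulVec_comp, comp_eq_zero_iff hker]
    exact ⟨y, mulVec_mulVec_of_mul_eq hBA y⟩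

include hS hker in
-- The cokernel of `A` over `R` is already killed by `w = A * B`, so it equals the cokernel over
-- `S`, and `A` itself is its resolution.
lemma projDimLT_two_coker (hw : w ∈ nonZeroDivisors R) {A B : Matrix ι ι R}
    (hAB : A * B = w • 1) (hBA : B * A = w • 1) :
    ProjDimLT R ((ι → S) ⧸ LinearMap.range (A.map (algebraMap R S)).mulVecLin) 2 := by
  have hfree : ProjDimLT R (ι → R) 1 := projDimLT_one_iff.2 inferInstance
  set K := LinearMap.range (A.map (algebraMap R S)).mulVecLin with hK
  refine ProjDimLT.cokernel (f := A.mulVecLin)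
    (g := (K.mkQ.restrictScalars R) ∘ₗ (Algebra.linearMap R S).compLeft ι)
    (mulVec_injective_of_mul_eq hw hBA) ?_ ?_ hfree (hfree.mono one_le_two)
  · intro x
    have h1 : ((K.mkQ.restrictScalars R) ∘ₗ (Algebra.linearMap R S).compLeft ι) x = 0 ↔
        algebraMap R S ∘ x ∈ K := by
      rw [← Submodule.Quotient.mk_eq_zero]; rfl
    rw [h1]
    constructor
    · rintro ⟨z, hz⟩
      obtain ⟨y, rfl⟩ := hS.comp_left z
      rw [map_mulVec_comp] at hz
      have h2 : algebraMap R S ∘ (x - A.mulVec y) = 0 := by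
        ext i
        have := congr_fun hz i
        simp only [Function.comp_apply, Pi.sub_apply, map_sub, Pi.zero_apply] at this ⊢
        rw [this, sub_self]
      obtain ⟨v, hv⟩ := (comp_eq_zero_iff hker _).1 h2
      refine ⟨y + B.mulVec v, ?_⟩
      rw [Matrix.mulVecLin_apply, Matrix.mulVec_add, mulVec_mulVec_of_mul_eq hAB, ← hv]
      abel
    · rintro ⟨y, rfl⟩
      exact ⟨_, map_mulVec_comp A y⟩
  · exact (Submodule.mkQ_surjective K).comp hS.comp_left

end

section Local

variable [IsLocalRing R] [IsLocalRing S] [IsNoetherianRing R]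

include hS hker in
/-- Over a hypersurface `S = R/w` with `w` a nonzerodivisor in the square of the maximal ideal
there is a finite module of finite projective dimension over `R` but not over `S`. -/
lemma exists_not_projDimLT (hw : w ∈ nonZeroDivisors R) (hwm : w ∈ maximalIdeal R ^ 2) :
    ∃ (M : Type u) (_ : AddCommGroup M) (_ : Module R M) (_ : Module S M)
      (_ : IsScalarTower R S M), Module.Finite S M ∧ ProjDimLT R M 2 ∧ ∀ n, ¬ ProjDimLT S M n := by
  obtain ⟨ι, _, _, _, A, B, hA, hB, hAB, hBA⟩ := hasMatrixFactorization_of_mem_sq hwm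
  have : IsNoetherianRing S := isNoetherianRing_of_surjective R S _ hS
  have : IsLocalHom (algebraMap R S) := IsLocalHom.of_surjective _ hS
  have hmap {x : R} (hx : x ∈ maximalIdeal R) : algebraMap R S x ∈ maximalIdeal S := by
    rw [← IsLocalRing.maximalIdeal_comap (algebraMap R S)] at hx
    exact hx
  refine ⟨(ι → S) ⧸ LinearMap.range (A.map (algebraMap R S)).mulVecLin, inferInstance,
    inferInstance, inferInstance, inferInstance, inferInstance,
    projDimLT_two_coker hS hker hw hAB hBA, fun n hn => ?_⟩
  exact not_projDimLT_of_exact n _ _ (exact_map_mulVecLin hS hker hw hAB hBA)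
    (exact_map_mulVecLin hS hker hw hBA hAB)
    (range_mulVecLin_le _ fun i j => hmap (hA i j))
    (range_mulVecLin_le _ fun i j => hmap (hB i j)) (hn.mono (by omega))

end Local

end MatrixFactorization

/-! ### Embedding dimension and codimension of a hypersurface -/

section EmbeddingDimension

open IsLocalRing

/-- Length is additive and unchanged along surjections of rings, so it compares cotangent spaces
over `R` and `S` without identifying residue fields. -/
lemma embDim_eq_length (R : Type u) [CommRing R] [IsLocalRing R] [IsNoetherianRing R] :
    (embDim R : ℕ∞) = Module.length R (maximalIdeal R).Cotangent := by
  rw [Module.length_eq_of_surjective (R := ResidueField R) residue_surjective]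
  exact (Module.length_eq_finrank (ResidueField R) (CotangentSpace R)).symm

variable {R S : Type u} [CommRing R] [CommRing S] [Algebra R S] {w : R}
  [IsLocalRing R] [IsLocalRing S] [IsNoetherianRing R]
  (hS : Function.Surjective (algebraMap R S))
  (hker : RingHom.ker (algebraMap R S) = Ideal.span {w})

include hS hker in
/-- Dividing by an element `w` of the maximal ideal preserves the embedding dimension if and only
if `w` is in the square of the maximal ideal. -/
lemma embDim_le_embDim_quotient_iff (hw : w ∈ maximalIdeal R) :
    embDim R ≤ embDim S ↔ w ∈ maximalIdeal R ^ 2 := by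
  have : IsNoetherianRing S := isNoetherianRing_of_surjective R S _ hS
  have : IsLocalHom (algebraMap R S) := IsLocalHom.of_surjective _ hS
  have hle : Ideal.span {w} ≤ maximalIdeal R := by
    rwa [Ideal.span_singleton_le_iff_mem]
  have heq : (maximalIdeal S).comap (algebraMap R S) =
      RingHom.ker (algebraMap R S) ⊔ maximalIdeal R := by
    rw [IsLocalRing.maximalIdeal_comap, hker, sup_eq_right.2 hle]
  set f := Ideal.mapCotangent (maximalIdeal R) (maximalIdeal S) (Algebra.ofId R S)
    (le_of_le_of_eq le_sup_right heq.symm) with hf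
  have hfs : Function.Surjective f := Ideal.mapCotangent_surjective_of_comap_eq hS heq
  have hkf : LinearMap.ker f = ⊥ ↔ w ∈ maximalIdeal R ^ 2 := by
    rw [hf, Ideal.mapCotangent_ker_of_surjective hS heq, hker, inf_eq_left.2 hle]
    constructor
    · intro h
      rw [← Ideal.toCotangent_eq_zero _ ⟨w, hw⟩, ← Submodule.mem_bot R, ← h]
      exact Submodule.mem_map_of_mem (Ideal.mem_span_singleton_self w)
    · intro h
      rw [eq_bot_iff]
      rintro _ ⟨x, hx, rfl⟩
      rw [Submodule.mem_bot, Ideal.toCotangent_eq_zero]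
      exact (Ideal.span_singleton_le_iff_mem _).2 h hx
  have hlen := Module.length_eq_add_of_exact (LinearMap.ker f).subtype f
    (LinearMap.ker f).subtype_injective hfs f.exact_subtype_ker_map
  rw [Module.length_eq_of_surjective (R := S) (M := (maximalIdeal S).Cotangent) hS,
    ← embDim_eq_length, ← embDim_eq_length] at hlen
  rw [← hkf, ← Submodule.subsingleton_iff_eq_bot, ← Module.length_eq_zero_iff (R := R),
    ← Nat.cast_le (α := ℕ∞), hlen]
  constructor
  · intro h
    by_contra h0
    generalize Module.length R (LinearMap.ker f) = c at h h0
    induction c with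
    | top => simp at h
    | coe c => norm_cast at h h0; omega
  · intro h
    rw [h, zero_add]

/-- The default values in `codim` are never used: the dimension of a Noetherian local ring is
finite. -/
lemma coe_unbotD_ringKrullDim (R : Type u) [CommRing R] [IsLocalRing R] [IsNoetherianRing R] :
    ((((ringKrullDim R).unbotD 0).toNat : ℕ∞) : WithBot ℕ∞) = ringKrullDim R := by
  have h1 : ringKrullDim R ≠ ⊥ := ringKrullDim_ne_bot
  have h2 : ringKrullDim R ≠ ⊤ := ringKrullDim_ne_top
  generalize ringKrullDim R = d at h1 h2
  induction d with
  | bot => exact absurd rfl h1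
  | coe d =>
    induction d with
    | top => exact absurd rfl h2
    | coe d => rfl

include hS hker in
lemma codim_lt_codim_quotient_iff (hw : w ∈ maximalIdeal R)
    (hdim : ringKrullDim R = ringKrullDim S + 1) :
    codim R < codim S ↔ w ∈ maximalIdeal R ^ 2 := by
  have : IsNoetherianRing S := isNoetherianRing_of_surjective R S _ hS
  rw [← embDim_le_embDim_quotient_iff hS hker hw, codim, codim]
  rw [← coe_unbotD_ringKrullDim R, ← coe_unbotD_ringKrullDim S] at hdim
  norm_cast at hdim
  omega

end EmbeddingDimension

/-! ### The local criterion -/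

section Hypersurface

open IsLocalRing

/-- For `S = R/w` with `w` a nonzerodivisor in the maximal ideal of the Noetherian local ring `R`,
finite `S`-modules that are perfect over `R` are perfect over `S` if and only if `w` is not in the
square of the maximal ideal. -/
lemma exists_not_isPerfect_iff {R S : Type u} [CommRing R] [CommRing S]
    [IsLocalRing R] [IsLocalRing S] [IsNoetherianRing R] (φ : R →+* S)
    (hφ : Function.Surjective φ) {w : R} (hker : RingHom.ker φ = Ideal.span {w})
    (hw : w ∈ nonZeroDivisors R) :
    (∃ M : ModuleCat.{u} S, Module.Finite S M ∧ ¬ IsPerfect M ∧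
      IsPerfect ((ModuleCat.restrictScalars φ).obj M)) ↔ w ∈ maximalIdeal R ^ 2 := by
  algebraize [φ]
  have : IsNoetherianRing S := isNoetherianRing_of_surjective R S _ hφ
  have : Module.Finite R S := Module.Finite.of_surjective (Algebra.linearMap R S) hφ
  constructor
  · rintro ⟨M, hM, hnp, hp⟩
    by_contra hwm
    let : Module R M := Module.compHom M φ
    have : IsScalarTower R S M := ⟨fun r s m => by
      rw [Algebra.smul_def, mul_smul]; rfl⟩
    obtain ⟨n, hn⟩ := hp.exists_hasProjectiveDimensionLT
    have hn' : ProjDimLT R M n := hn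
    exact hnp ((isPerfect_iff M).2
      ⟨n + 1, projDimLT_quotient hφ hker hw hwm n (hn'.mono (by omega))⟩)
  · intro hwm
    obtain ⟨M, _, m, _, _, hM, hp, hnp⟩ := exists_not_projDimLT (S := S) hφ hker hw hwm
    refine ⟨ModuleCat.of S M, hM, fun h => ?_, ?_⟩
    · obtain ⟨n, hn⟩ := h.exists_hasProjectiveDimensionLT
      exact hnp n hn
    · have : Module.Finite R M := Module.Finite.trans S M
      have hR := (isPerfect_iff M).2 ⟨2, hp⟩
      -- The scalar tower forces the given `R`-structure to be restriction of scalars.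
      obtain rfl : m = Module.compHom M φ :=
        Module.ext' _ _ fun r x => (algebraMap_smul S r x).symm
      exact hR

end Hypersurface

/-! ### Local equation of the zero scheme -/

section Stalks

variable {X : Scheme.{u}} {L : X.Modules} (hL : IsInvertibleSheaf L) (W : Γ(L, ⊤))

lemma germ_resO {U V : X.Opens} (h : V ≤ U) (x : X) (hx : x ∈ V) (f : Γ(X, U)) :
    X.presheaf.germ V x hx (resO h f) = X.presheaf.germ U x (h hx) f :=
  X.presheaf.germ_res_apply (homOfLE h) x hx f

lemma exists_resO_eq_zero {U : X.Opens} (x : X) (hx : x ∈ U) (f : Γ(X, U))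
    (h : X.presheaf.germ U x hx f = 0) : ∃ (V : X.Opens) (hV : V ≤ U), x ∈ V ∧ resO hV f = 0 := by
  obtain ⟨V, hxV, i, i', hi⟩ := X.presheaf.germ_eq x hx hx f 0 (h.trans (map_zero _).symm)
  exact ⟨V, i.le, hxV, hi.trans (map_zero _)⟩

include hL in
/-- Around every point there is an affine open on which `W` is a multiple of a frame. -/
lemma exists_affine_frame (x : X) :
    ∃ V : X.Opens, IsAffineOpen V ∧ x ∈ V ∧ ∃ e : Γ(L, V), IsFrame L e ∧
      ∃ w : Γ(X, V), res L le_top W = w • e := by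
  obtain ⟨U, hxU, e, he⟩ := hL x
  obtain ⟨_, ⟨V, hV, rfl⟩, hxV, hVU⟩ := X.isBasis_affineOpens.exists_subset_of_mem_open hxU U.2
  have hle : V ≤ U := hVU
  obtain ⟨w, hw⟩ := (he V hle).2 (res L le_top W)
  exact ⟨V, hV, hxV, res L hle e, he.res hle, w, hw.symm⟩

variable {W} in
-- A relation `a w = 0` in the stalk spreads out to `f w = 0` on a neighbourhood, where `f W = f w e
-- = 0` and injectivity of `W` applies.
lemma germ_mem_nonZeroDivisors (hW : IsNonZeroDivisorSection W) {V : X.Opens} {e : Γ(L, V)}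
    {w : Γ(X, V)} (hw : res L le_top W = w • e) (x : X) (hx : x ∈ V) :
    X.presheaf.germ V x hx w ∈ nonZeroDivisors (X.presheaf.stalk x) := by
  rw [mem_nonZeroDivisors_iff_right]
  intro a ha
  obtain ⟨U, hxU, f, rfl⟩ := X.presheaf.exists_germ_eq a
  have h1 := germ_resO (inf_le_left : U ⊓ V ≤ U) x ⟨hxU, hx⟩ f
  have h2 := germ_resO (inf_le_right : U ⊓ V ≤ V) x ⟨hxU, hx⟩ w
  rw [← h1, ← h2, ← map_mul] at ha
  obtain ⟨V', hle, hxV', hz⟩ := exists_resO_eq_zero x _ _ ha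
  rw [resO_mul, resO_resO, resO_resO] at hz
  have hf0 : resO (hle.trans inf_le_left) f = 0 := by
    apply hW V'
    simp only
    rw [zero_smul, ← res_res (le_top : V ≤ ⊤) (hle.trans inf_le_right), hw, res_smul, smul_smul, hz,
      zero_smul]
  rw [← germ_resO (hle.trans inf_le_left) x hxV' f, hf0, map_zero]

lemma ker_stalkMap_zeroSchemeι (p : zeroScheme hL W) {V : X.Opens} (hV : IsAffineOpen V)
    (hp : zeroSchemeι hL W p ∈ V) {e : Γ(L, V)} (he : IsFrame L e) {w : Γ(X, V)}
    (hw : res L le_top W = w • e) :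
    RingHom.ker ((zeroSchemeι hL W).stalkMap p).hom =
      Ideal.span {X.presheaf.germ V (zeroSchemeι hL W p) hp w} := by
  let ι := zeroSchemeι hL W
  apply le_antisymm
  · intro a ha
    obtain ⟨U, hU, f, rfl⟩ := X.presheaf.exists_germ_eq a
    rw [RingHom.mem_ker] at ha
    have ha' : (zeroScheme hL W).presheaf.germ (ι ⁻¹ᵁ U) p hU (ι.app U f) = 0 := by
      rw [← ha]
      exact (Scheme.Hom.germ_stalkMap_apply ι U p hU f).symm
    obtain ⟨T, hTU, hpT, hT0⟩ := exists_resO_eq_zero p hU _ ha'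
    -- The neighbourhood `T` on which the pullback of `f` vanishes is the trace of an open set of
    -- `X`; shrinking to an affine `V'` inside it puts `f` in the ideal generated by `w`.
    obtain ⟨T', hT'o, hT'⟩ := (ι.isClosedEmbedding.isInducing.isOpen_iff).1 T.2
    obtain ⟨_, ⟨V', hV', rfl⟩, hpV', hV'U⟩ := X.isBasis_affineOpens.exists_subset_of_mem_open
      (show ι p ∈ (T' ∩ (U ⊓ V : X.Opens) : Set X) from
        ⟨by rw [← Set.mem_preimage, hT']; exact hpT, hU, hp⟩)
      (hT'o.inter (U ⊓ V).2)
    have hVU : V' ≤ U := fun x hx => (hV'U hx).2.1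
    have hVV : V' ≤ V := fun x hx => (hV'U hx).2.2
    have hVT : ι ⁻¹ᵁ V' ≤ T := fun x hx => by
      have : x ∈ ι ⁻¹' T' := (hV'U hx).1
      rw [hT'] at this
      exact this
    have hzero : ι.app V' (resO hVU f) = 0 := by
      have hnat : ι.app V' (resO hVU f) =
          resO (ι.preimage_mono hVU) (ι.app U f) :=
        ConcreteCategory.congr_hom (ι.naturality (homOfLE hVU).op) f
      rw [hnat, ← resO_resO hTU hVT, hT0]
      exact map_zero _
    have hmem : resO hVU f ∈ (zeroIdeal hL W).ideal ⟨V', hV'⟩ := by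
      rw [← Scheme.IdealSheafData.ker_subschemeι_app, RingHom.mem_ker]
      exact hzero
    change resO hVU f ∈ zeroIdealAux hL W V' at hmem
    rw [zeroIdealAux_eq_span hL W hV' (he.res hVV) (w := resO hVV w)
      (by rw [← res_smul, ← hw, res_res]), Ideal.mem_span_singleton] at hmem
    obtain ⟨g, hg⟩ := hmem
    rw [Ideal.mem_span_singleton, ← germ_resO hVU _ hpV', hg, map_mul, germ_resO]
    exact Dvd.intro _ rfl
  · rw [Ideal.span_singleton_le_iff_mem, RingHom.mem_ker]
    have hmem : w ∈ (zeroIdeal hL W).ideal ⟨V, hV⟩ := by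
      change w ∈ zeroIdealAux hL W V
      rw [zeroIdealAux_eq_span hL W hV he hw]
      exact Ideal.mem_span_singleton_self w
    rw [← Scheme.IdealSheafData.ker_subschemeι_app, RingHom.mem_ker] at hmem
    refine (Scheme.Hom.germ_stalkMap_apply ι V p hp w).trans ?_
    exact (congr_arg _ hmem).trans (map_zero _)

end Stalks

end RelSing

end

theorem mainTheorem10 {X : Scheme.{u}} [AlgebraicGeometry.IsNoetherian X] (L : X.Modules)
    (hL : RelSing.IsInvertibleSheaf L) (W : Γ(L, ⊤)) (hW : RelSing.IsNonZeroDivisorSection W)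
    (hdim : ∀ p : RelSing.zeroScheme hL W,
      ringKrullDim (X.presheaf.stalk (RelSing.zeroSchemeι hL W p)) =
        ringKrullDim ((RelSing.zeroScheme hL W).presheaf.stalk p) + 1) :
    RelSing.singLoc (RelSing.zeroSchemeι hL W) =
      {p : RelSing.zeroScheme hL W |
        RelSing.codim ((RelSing.zeroScheme hL W).presheaf.stalk p) >
          RelSing.codim (X.presheaf.stalk (RelSing.zeroSchemeι hL W p))} := by
  ext p
  obtain ⟨V, hV, hp, e, he, w, hw⟩ := RelSing.exists_affine_frame hL W (RelSing.zeroSchemeι hL W p)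
  have hker := RelSing.ker_stalkMap_zeroSchemeι hL W p hV hp he hw
  have hsurj := (RelSing.zeroSchemeι hL W).stalkMap_surjective p
  have hnzd := RelSing.germ_mem_nonZeroDivisors hW hw _ hp
  let := ((RelSing.zeroSchemeι hL W).stalkMap p).hom.toAlgebra
  have hmax : X.presheaf.germ V _ hp w ∈
      IsLocalRing.maximalIdeal (X.presheaf.stalk (RelSing.zeroSchemeι hL W p)) := by
    -- The germ of `w` lies in the kernel of a map to a nonzero ring, a proper ideal.
    refine IsLocalRing.le_maximalIdeal
      (RingHom.ker_ne_top ((RelSing.zeroSchemeι hL W).stalkMap p).hom) ?_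
    rw [hker]
    exact Ideal.mem_span_singleton_self _
  exact (RelSing.exists_not_isPerfect_iff _ hsurj hker hnzd).trans
    (RelSing.codim_lt_codim_quotient_iff hsurj hker hmax (hdim p)).symm
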